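/- For integers $n\ge 1$, $k_1,\dots,k_{n-1}\ge 1$ and $k_n\ge 2$, let $$\zeta^{\star}(k_1,\dots,k_n)=\sum_{1\le m_1\le\cdots\le m_n<\infty}\frac{1}{m_1^{k_1}\cdots m_n^{k_n}},\qquad \zeta^{\star}_{-}(k_1,\dots,k_n)=\sum_{1\le m_1\le\cdots\le m_n<\infty}\frac{(-1)^{m_n-1}}{m_1^{k_1}\cdots m_n^{k_n}},$$ let $\{1\}^{a}$ denote $1,\dots,1$ ($a$ times, empty for $a=0$), and let $\binom{x}{i}=x(x-1)\cdots(x-i+1)/i!$ for integers $x$ and $i\ge0$ (so $\binom{-1}{0}=1$). Then for all integers $r\ge 0$ and $s\ge 1$ all of the series of this form occurring below converge absolutely, and $$\sum_{i=0}^{r}\left\{\binom{s-2+i}{i}+\binom{s-1+i}{i}\right\}\zeta^{\star}_{-}(\{1\}^{r-i},2s+i) =\sum_{\substack{r_1+\cdots+r_s=r\\ r_1,\dots,r_s\in\mathbb{Z}_{\ge0}}}(r_1+1)\,\zeta^{\star}(r_1+2,\dots,r_s+2).$$ -/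

import Mathlib

/-- The index set of the star sums: tuples `(m₁, …, mₙ)` of integers with `1 ≤ m₁ ≤ ⋯ ≤ mₙ`. -/
def StarIndex (n : ℕ) : Type :=
  {m : Fin n → ℕ // Monotone m ∧ ∀ j, 1 ≤ m j}

/-- The summand `z ^ (mₙ - 1) / (m₁ ^ k₁ ⋯ mₙ ^ kₙ)`; the last of the `n ≥ 1` entries of `m` has
index `n - 1` in `Fin n`, and `mₙ ≥ 1`, so both natural-number subtractions are genuine. -/
noncomputable def mplStarTerm (z : ℝ) {n : ℕ} (hn : 1 ≤ n) (k : Fin n → ℕ) (m : StarIndex n) : ℝ :=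
  z ^ (m.1 ⟨n - 1, Nat.sub_lt hn Nat.one_pos⟩ - 1) / ∏ j, (m.1 j : ℝ) ^ k j

/-- The star-type special value of a multiple polylogarithm,
`∑_{1 ≤ m₁ ≤ ⋯ ≤ mₙ < ∞} z ^ (mₙ - 1) / (m₁ ^ k₁ ⋯ mₙ ^ kₙ)`. -/
noncomputable def mplStar (z : ℝ) {n : ℕ} (hn : 1 ≤ n) (k : Fin n → ℕ) : ℝ :=
  ∑' m : StarIndex n, mplStarTerm z hn k m

/-- The multiple zeta-star value `ζ^⋆(k₁, …, kₙ)`. -/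
noncomputable def zetaStar {n : ℕ} (hn : 1 ≤ n) (k : Fin n → ℕ) : ℝ :=
  mplStar 1 hn k

/-- The alternating value `ζ₋^⋆(k₁, …, kₙ)`. -/
noncomputable def zetaStarMinus {n : ℕ} (hn : 1 ≤ n) (k : Fin n → ℕ) : ℝ :=
  mplStar (-1) hn k

/-- The index `({1}^a, b) = (1, …, 1, b)` with `a` ones. -/
def onesThen (a b : ℕ) : Fin (a + 1) → ℕ :=
  Fin.snoc (α := fun _ => ℕ) (fun _ : Fin a => 1) b

open Finset Filter Topology PowerSeries

/-! Both sides are the coefficient of `X ^ r` in one generating function. Truncating at `N`, the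
right side comes from the sum over `m₁ ≤ ⋯ ≤ m_s ≤ N` of `m₁/(m₁ - X) · ∏ 1/(mⱼ(mⱼ - X))`, where the
extra factor at `m₁` produces the weight `r₁ + 1` (`coeff_pfSum`). This nested sum equals a single
sum `∑ₘ c(N,m) (m(m - X))⁻ˢ` (`pfSum`). To see this, check that both obey the same recursion in `s`
and `N` (`pfCoeff_shift`, `pfSum_succ`) and agree at `s = 0` by telescoping (`sum_pfCoeff`).

As `N → ∞` the only factor depending on `N`, `ratioProd`, tends to `1` coefficientwise. What remains
is `∑ₘ (-1)^(m-1) (2 - X/m) (m(m - X))⁻ˢ ∏_{j ≤ m} (1 - X/j)⁻¹`. The product generates the star sums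
over `{1}ᵃ` (`coeff_harmProd`), and the other factors generate the two binomials over `m^(2s+i)`
(`coeff_weightSeries`), so the left side appears. The exchange of limit and sum is dominated
convergence (`tendsto_coeff_pfSum`). -/

/-! ### Truncated star sums as iterated and as box sums. -/

/-- The truncated star sum `∑_{1 ≤ m₁ ≤ ⋯ ≤ mₙ ≤ N} 1 / (m₁ ^ k₁ ⋯ mₙ ^ kₙ)`. -/
noncomputable def truncStar : (n : ℕ) → (Fin n → ℕ) → ℕ → ℝ
  | 0, _, _ => 1
  | n + 1, k, N => ∑ M ∈ range N,
      (((M + 1 : ℕ) : ℝ) ^ k (Fin.last n))⁻¹ * truncStar n (Fin.init k) (M + 1)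

/-- The tuples `1 ≤ m₁ ≤ ⋯ ≤ mₙ ≤ N`. -/
noncomputable def starBox (n N : ℕ) : Finset (Fin n → ℕ) :=
  (Fintype.piFinset fun _ => Icc 1 N).filter Monotone

theorem mem_starBox {n N : ℕ} {m : Fin n → ℕ} :
    m ∈ starBox n N ↔ (∀ j, 1 ≤ m j ∧ m j ≤ N) ∧ Monotone m := by
  simp [starBox]

theorem monotone_snoc_iff {n : ℕ} {m : Fin n → ℕ} {M : ℕ} :
    Monotone (Fin.snoc (α := fun _ => ℕ) m M) ↔ Monotone m ∧ ∀ j, m j ≤ M := by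
  constructor
  · intro h
    refine ⟨fun i j hij => ?_, fun j => ?_⟩
    · simpa using h (Fin.castSucc_le_castSucc_iff.2 hij)
    · simpa using h (Fin.le_last j.castSucc)
  · rintro ⟨h1, h2⟩ i j
    refine Fin.lastCases ?_ (fun j => ?_) j
    · refine Fin.lastCases ?_ (fun i => ?_) i
      · simp
      · simpa using fun _ => h2 i
    · refine Fin.lastCases ?_ (fun i => ?_) i
      · intro h
        exact absurd h (not_le.2 (Fin.castSucc_lt_last j))
      · intro h
        simpa using h1 (Fin.castSucc_le_castSucc_iff.1 h)

theorem sum_starBox_succ {n N : ℕ} (f : (Fin (n + 1) → ℕ) → ℝ) :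
    ∑ m ∈ starBox (n + 1) N, f m =
      ∑ M ∈ range N, ∑ m ∈ starBox n (M + 1), f (Fin.snoc (α := fun _ => ℕ) m (M + 1)) := by
  rw [Finset.sum_sigma']
  symm
  refine Finset.sum_bij' (fun p _ => Fin.snoc (α := fun _ => ℕ) p.2 (p.1 + 1))
    (fun m _ => ⟨m (Fin.last n) - 1, Fin.init m⟩) ?_ ?_ ?_ ?_ ?_
  · rintro ⟨M, m⟩ h
    simp only [mem_sigma, mem_range, mem_starBox] at h ⊢
    obtain ⟨hM, h1, h2⟩ := h
    refine ⟨fun j => ?_, monotone_snoc_iff.2 ⟨h2, fun j => (h1 j).2⟩⟩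
    refine Fin.lastCases ?_ (fun j => ?_) j
    · simp; omega
    · have := h1 j
      simp; omega
  · intro m h
    simp only [mem_sigma, mem_range, mem_starBox] at h ⊢
    obtain ⟨h1, h2⟩ := h
    have h3 := h1 (Fin.last n)
    refine ⟨by omega, fun j => ⟨(h1 _).1, ?_⟩, fun i j hij =>
      h2 (Fin.castSucc_le_castSucc_iff.2 hij)⟩
    have := h2 (Fin.le_last j.castSucc)
    simp only [Fin.init]
    omega
  · rintro ⟨M, m⟩ h
    simp
  · intro m h
    have h3 := (mem_starBox.1 h).1 (Fin.last n)
    have : m (Fin.last n) - 1 + 1 = m (Fin.last n) := by omega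
    simp [this]
  · intro p h
    rfl

theorem truncStar_eq_sum (n : ℕ) (k : Fin n → ℕ) (N : ℕ) :
    truncStar n k N = ∑ m ∈ starBox n N, (∏ j, (m j : ℝ) ^ k j)⁻¹ := by
  induction n generalizing N with
  | zero =>
    have : starBox 0 N = {Fin.elim0} := by
      ext m
      simp only [mem_starBox, mem_singleton]
      exact ⟨fun _ => Subsingleton.elim _ _, fun _ => ⟨fun j => j.elim0, fun j => j.elim0⟩⟩
    simp [truncStar, this]
  | succ n ih =>
    rw [sum_starBox_succ, truncStar]
    refine sum_congr rfl fun M _ => ?_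
    rw [ih, mul_sum]
    refine sum_congr rfl fun m _ => ?_
    rw [Fin.prod_univ_castSucc]
    simp only [Fin.snoc_castSucc, Fin.snoc_last, Fin.init, mul_inv]
    ring

theorem truncStar_nonneg (n : ℕ) (k : Fin n → ℕ) (N : ℕ) : 0 ≤ truncStar n k N := by
  rw [truncStar_eq_sum]
  positivity

/-! ### Growth of truncated sums. -/

/-- The fourth root of a natural number. -/
noncomputable def natRoot (N : ℕ) : ℝ := (N : ℝ) ^ (1 / 4 : ℝ)

theorem natRoot_nonneg (N : ℕ) : 0 ≤ natRoot N := by unfold natRoot; positivity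

theorem natRoot_pow (N : ℕ) : natRoot N ^ 4 = N := by
  rw [natRoot, ← Real.rpow_natCast, ← Real.rpow_mul (by positivity)]
  norm_num

theorem one_le_natRoot (N : ℕ) : 1 ≤ natRoot (N + 1) :=
  Real.one_le_rpow (by push_cast; linarith [(Nat.cast_nonneg N : (0 : ℝ) ≤ N)]) (by norm_num)

/-- With `u`, `v` the two roots, `1 = u⁴ - v⁴ ≤ 4(u - v)u³`; multiply by `u`. This makes sums of
`N^(1/4) / N` telescope. -/
theorem natRoot_step (N : ℕ) :
    natRoot (N + 1) / ((N + 1 : ℕ) : ℝ) ≤ 4 * (natRoot (N + 1) - natRoot N) := by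
  have hu := natRoot_pow (N + 1)
  have hv := natRoot_pow N
  have hu0 := one_le_natRoot N
  have hv0 := natRoot_nonneg N
  have huv : natRoot N ≤ natRoot (N + 1) :=
    Real.rpow_le_rpow (by positivity) (by push_cast; linarith) (by norm_num)
  rw [div_le_iff₀ (by positivity), ← hu]
  generalize natRoot (N + 1) = u at *
  generalize natRoot N = v at *
  have key : u ^ 4 - v ^ 4 = 1 := by rw [hu, hv]; push_cast; ring
  have h3 : u ^ 4 - v ^ 4 ≤ 4 * (u - v) * u ^ 3 := by
    have e : u ^ 4 - v ^ 4 = (u - v) * (u ^ 3 + u ^ 2 * v + u * v ^ 2 + v ^ 3) := by ring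
    have h1 : u ^ 2 * v ≤ u ^ 2 * u := by gcongr
    have h2 : u * v ^ 2 ≤ u * u ^ 2 := by gcongr
    have h4 : v ^ 3 ≤ u ^ 3 := by gcongr
    rw [e]
    calc _ ≤ (u - v) * (4 * u ^ 3) :=
          mul_le_mul_of_nonneg_left (by linarith) (by linarith)
      _ = _ := by ring
  calc u = u * 1 := by ring
    _ ≤ u * (4 * (u - v) * u ^ 3) := by gcongr; linarith
    _ = _ := by ring

/-- The fourth root stands in for powers of the logarithm: even the product of two such bounds,
`N^(1/2)`, is summable against `1/N²`. -/
theorem truncStar_le (n : ℕ) (k : Fin n → ℕ) (hk : ∀ j, 1 ≤ k j) (N : ℕ) :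
    truncStar n k (N + 1) ≤ 4 ^ n * natRoot (N + 1) := by
  induction n generalizing N with
  | zero => simpa [truncStar] using one_le_natRoot N
  | succ n ih =>
    have aux : ∀ N, truncStar (n + 1) k N ≤ 4 ^ (n + 1) * natRoot N := by
      intro N
      induction N with
      | zero => simp [truncStar, natRoot]
      | succ N ihN =>
        have hstep : truncStar (n + 1) k (N + 1) = truncStar (n + 1) k N +
            (((N + 1 : ℕ) : ℝ) ^ k (Fin.last n))⁻¹ * truncStar n (Fin.init k) (N + 1) := by
          simp only [truncStar, sum_range_succ]
        have h1 : (((N + 1 : ℕ) : ℝ) ^ k (Fin.last n))⁻¹ ≤ (((N + 1 : ℕ) : ℝ))⁻¹ := by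
          refine inv_anti₀ (by positivity) (le_self_pow₀ ?_ ?_)
          · exact_mod_cast Nat.le_add_left 1 N
          · have := hk (Fin.last n); omega
        have h2 := ih (Fin.init k) (fun j => hk _) N
        have h3 := natRoot_step N
        calc _ = _ := hstep
          _ ≤ 4 ^ (n + 1) * natRoot N +
              (((N + 1 : ℕ) : ℝ))⁻¹ * (4 ^ n * natRoot (N + 1)) := by
            refine add_le_add ihN (mul_le_mul h1 h2 (truncStar_nonneg _ _ _) (by positivity))
          _ = 4 ^ (n + 1) * natRoot N + 4 ^ n * (natRoot (N + 1) / ((N + 1 : ℕ) : ℝ)) := by ring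
          _ ≤ 4 ^ (n + 1) * natRoot N + 4 ^ n * (4 * (natRoot (N + 1) - natRoot N)) := by gcongr
          _ = _ := by ring
    exact aux (N + 1)

theorem summable_natRoot_sq_div : Summable fun M : ℕ =>
    natRoot (M + 1) ^ 2 / ((M + 1 : ℕ) : ℝ) ^ 2 := by
  have h : Summable fun M : ℕ => 1 / ((M : ℕ) : ℝ) ^ (3 / 2 : ℝ) :=
    Real.summable_one_div_nat_rpow.2 (by norm_num)
  refine ((summable_nat_add_iff 1).2 h).congr fun M => ?_
  have hp : (0 : ℝ) < ((M + 1 : ℕ) : ℝ) := by positivity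
  rw [natRoot, ← Real.rpow_natCast, ← Real.rpow_natCast, ← Real.rpow_mul hp.le,
    ← Real.rpow_sub hp, one_div, ← Real.rpow_neg hp.le]
  norm_num

/-! ### Absolute convergence and reduction to the last variable. -/

/-- The terms of a star sum after summing over all variables but the last. -/
noncomputable def outerTerm (z : ℝ) (n : ℕ) (k : Fin (n + 1) → ℕ) (M : ℕ) : ℝ :=
  z ^ M * ((((M + 1 : ℕ) : ℝ) ^ k (Fin.last n))⁻¹ * truncStar n (Fin.init k) (M + 1))

theorem summable_abs_outerTerm {z : ℝ} (hz : |z| ≤ 1) {n : ℕ} {k : Fin (n + 1) → ℕ}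
    (hk : ∀ j, 1 ≤ k j) (hlast : 2 ≤ k (Fin.last n)) :
    Summable fun M => |outerTerm z n k M| := by
  refine Summable.of_nonneg_of_le (fun _ => abs_nonneg _) (fun M => ?_)
    (summable_natRoot_sq_div.mul_left (4 ^ n))
  have h0 := truncStar_nonneg n (Fin.init k) (M + 1)
  have h1 := truncStar_le n (Fin.init k) (fun j => hk _) M
  have h2 : (((M + 1 : ℕ) : ℝ) ^ k (Fin.last n))⁻¹ ≤ (((M + 1 : ℕ) : ℝ) ^ 2)⁻¹ :=
    inv_anti₀ (by positivity) (pow_le_pow_right₀ (by exact_mod_cast Nat.le_add_left 1 M) hlast)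
  have h3 := one_le_natRoot M
  rw [outerTerm, abs_mul, abs_pow, abs_of_nonneg (mul_nonneg (by positivity) h0)]
  calc |z| ^ M * _ ≤ 1 * ((((M + 1 : ℕ) : ℝ) ^ 2)⁻¹ * (4 ^ n * natRoot (M + 1))) := by
        refine mul_le_mul (pow_le_one₀ (abs_nonneg _) hz)
          (mul_le_mul h2 h1 h0 (by positivity)) (mul_nonneg (by positivity) h0) zero_le_one
    _ = 4 ^ n * (natRoot (M + 1) * 1 / ((M + 1 : ℕ) : ℝ) ^ 2) := by ring
    -- A spare factor `natRoot ≥ 1` is inserted so that the majorant of the later limit argument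
    -- serves here too.
    _ ≤ 4 ^ n * (natRoot (M + 1) * natRoot (M + 1) / ((M + 1 : ℕ) : ℝ) ^ 2) := by
        gcongr
    _ = _ := by ring

/-- The finite set of admissible tuples bounded by `N`, inside the index type. -/
noncomputable def starFinset (n N : ℕ) : Finset (StarIndex n) :=
  open Classical in
  (Fintype.piFinset fun _ => Icc 1 N).subtype fun m : Fin n → ℕ => Monotone m ∧ ∀ j, 1 ≤ m j

theorem mem_starFinset {n N : ℕ} {m : StarIndex n} : m ∈ starFinset n N ↔ ∀ j, m.1 j ≤ N := by
  classical
  rw [starFinset]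
  refine Finset.mem_subtype.trans ?_
  simp only [Fintype.mem_piFinset, mem_Icc]
  exact ⟨fun h j => (h j).2, fun h j => ⟨m.2.2 j, h j⟩⟩

theorem sum_starFinset (n N : ℕ) (f : (Fin n → ℕ) → ℝ) :
    ∑ m ∈ starFinset n N, f m.1 = ∑ m ∈ starBox n N, f m := by
  refine Finset.sum_bij (fun m _ => m.1) ?_ ?_ ?_ ?_
  · intro m hm
    exact mem_starBox.2 ⟨fun j => ⟨m.2.2 j, mem_starFinset.1 hm j⟩, m.2.1⟩
  · intro a _ b _ h
    exact Subtype.ext h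
  · intro m hm
    obtain ⟨h1, h2⟩ := mem_starBox.1 hm
    exact ⟨⟨m, h2, fun j => (h1 j).1⟩, mem_starFinset.2 fun j => (h1 j).2, rfl⟩
  · intro _ _
    rfl

theorem tendsto_starFinset (n : ℕ) : Tendsto (starFinset n) atTop atTop := by
  refine tendsto_atTop_finset_of_monotone (fun a b hab m hm => ?_) fun m => ?_
  · exact mem_starFinset.2 fun j => (mem_starFinset.1 hm j).trans hab
  · exact ⟨∑ j, m.1 j, mem_starFinset.2 fun j =>
      single_le_sum (f := m.1) (fun _ _ => Nat.zero_le _) (mem_univ j)⟩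

theorem sum_starFinset_mplStarTerm (z : ℝ) (n : ℕ) (hn : 1 ≤ n + 1) (k : Fin (n + 1) → ℕ)
    (N : ℕ) :
    ∑ m ∈ starFinset (n + 1) N, mplStarTerm z hn k m = ∑ M ∈ range N, outerTerm z n k M := by
  have h := sum_starFinset (n + 1) N fun m =>
    z ^ (m (Fin.last n) - 1) / ∏ j, (m j : ℝ) ^ k j
  refine Eq.trans h ?_
  rw [sum_starBox_succ]
  refine sum_congr rfl fun M _ => ?_
  rw [outerTerm, truncStar_eq_sum, mul_sum, mul_sum]
  refine sum_congr rfl fun m _ => ?_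
  rw [Fin.prod_univ_castSucc]
  simp only [Fin.snoc_castSucc, Fin.snoc_last, Fin.init, Nat.add_sub_cancel, div_eq_mul_inv,
    mul_inv]
  ring

theorem abs_mplStarTerm (z : ℝ) {n : ℕ} (hn : 1 ≤ n) (k : Fin n → ℕ) (m : StarIndex n) :
    |mplStarTerm z hn k m| = mplStarTerm |z| hn k m := by
  rw [mplStarTerm, mplStarTerm, abs_div, abs_pow, abs_of_nonneg (by positivity : (0 : ℝ) ≤ ∏ j, _)]

theorem summable_mplStarTerm {z : ℝ} (hz : |z| ≤ 1) {n : ℕ} (hn : 1 ≤ n + 1)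
    {k : Fin (n + 1) → ℕ} (hk : ∀ j, 1 ≤ k j) (hlast : 2 ≤ k (Fin.last n)) :
    Summable (mplStarTerm z hn k) := by
  rw [← summable_abs_iff]
  have hs := summable_abs_outerTerm (z := |z|) (by rwa [abs_abs]) hk hlast
  refine summable_of_sum_le (c := ∑' M, |outerTerm |z| n k M|) (fun _ => abs_nonneg _) fun u => ?_
  obtain ⟨N, hN⟩ := ((tendsto_starFinset (n + 1)).eventually_ge_atTop u).exists
  calc ∑ m ∈ u, |mplStarTerm z hn k m|
      ≤ ∑ m ∈ starFinset (n + 1) N, |mplStarTerm z hn k m| :=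
        sum_le_sum_of_subset_of_nonneg hN fun _ _ _ => abs_nonneg _
    _ = ∑ M ∈ range N, outerTerm |z| n k M := by
        simp only [abs_mplStarTerm, sum_starFinset_mplStarTerm]
    _ ≤ ∑ M ∈ range N, |outerTerm |z| n k M| := sum_le_sum fun _ _ => le_abs_self _
    _ ≤ _ := hs.sum_le_tsum _ fun _ _ => abs_nonneg _

theorem tendsto_sum_outerTerm {z : ℝ} (hz : |z| ≤ 1) {n : ℕ} (hn : 1 ≤ n + 1)
    {k : Fin (n + 1) → ℕ} (hk : ∀ j, 1 ≤ k j) (hlast : 2 ≤ k (Fin.last n)) :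
    Tendsto (fun N => ∑ M ∈ range N, outerTerm z n k M) atTop (𝓝 (mplStar z hn k)) := by
  have h := (summable_mplStarTerm hz hn hk hlast).hasSum.comp (tendsto_starFinset (n + 1))
  exact h.congr fun N => sum_starFinset_mplStarTerm z n hn k N

theorem hasSum_outerTerm {z : ℝ} (hz : |z| ≤ 1) {n : ℕ} (hn : 1 ≤ n + 1)
    {k : Fin (n + 1) → ℕ} (hk : ∀ j, 1 ≤ k j) (hlast : 2 ≤ k (Fin.last n)) :
    HasSum (outerTerm z n k) (mplStar z hn k) := by
  have hs := (summable_abs_iff.1 (summable_abs_outerTerm hz hk hlast)).hasSum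
  rwa [tendsto_nhds_unique hs.tendsto_sum_nat (tendsto_sum_outerTerm hz hn hk hlast)] at hs

/-! ### Partial fractions of the truncated generating function. -/

/-- The power series expansion of `1 / (a - X)`. -/
noncomputable def invSubX (a : ℝ) : PowerSeries ℝ := PowerSeries.mk fun n => (a⁻¹) ^ (n + 1)

theorem sub_X_mul_invSubX {a : ℝ} (ha : a ≠ 0) : (C a - X) * invSubX a = 1 := by
  ext n
  cases n with
  | zero => simp [sub_mul, invSubX, ha]
  | succ n =>
    rw [sub_mul, map_sub, coeff_C_mul, coeff_succ_X_mul, coeff_one]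
    simp [invSubX]
    field_simp
    ring

/-- `∏_{j=1}^m (1 - X/j)⁻¹`. -/
noncomputable def harmProd (m : ℕ) : PowerSeries ℝ :=
  ∏ j ∈ range m, (C ((j + 1 : ℕ) : ℝ) * invSubX ((j + 1 : ℕ) : ℝ))

/-- `∏_{j<m} (N - j) / (N + 1 + j - X)`. -/
noncomputable def ratioProd (N m : ℕ) : PowerSeries ℝ :=
  ∏ j ∈ range m, (C ((N : ℝ) - j) * invSubX ((N + 1 + j : ℕ) : ℝ))

theorem ratioProd_shift (N m : ℕ) :
    C ((N : ℝ) + 1) * (C ((N : ℝ) + 1) - X) * ratioProd N m =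
      (C ((N : ℝ) + 1 - m) * (C ((N : ℝ) + 1 + m) - X)) * ratioProd (N + 1) m := by
  induction m with
  | zero => simp [ratioProd]
  | succ m ih =>
    have h1 : ratioProd N (m + 1) =
        ratioProd N m * (C ((N : ℝ) - m) * invSubX ((N : ℝ) + 1 + m)) := by
      rw [ratioProd, prod_range_succ, ← ratioProd]; push_cast; rfl
    have h2 : ratioProd (N + 1) (m + 1) =
        ratioProd (N + 1) m * (C ((N : ℝ) + 1 - m) * invSubX ((N : ℝ) + 1 + 1 + m)) := by
      rw [ratioProd, prod_range_succ, ← ratioProd]; push_cast; rfl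
    have e1 := sub_X_mul_invSubX (a := (N : ℝ) + 1 + m) (by positivity)
    have e2 := sub_X_mul_invSubX (a := (N : ℝ) + 1 + 1 + m) (by positivity)
    rw [h1, h2]
    simp only [map_add, map_sub, map_natCast, Nat.cast_add, Nat.cast_one, map_one] at *
    linear_combination ((N : PowerSeries ℝ) - m) * invSubX ((N : ℝ) + 1 + m) * ih +
      ((N : PowerSeries ℝ) - m) * (N + 1 - m) * ratioProd (N + 1) m * (e1 - e2)

/-- The coefficient of `(m (m - X))⁻ˢ`, `m = k + 1`, in the partial fraction expansion of the
generating function of the star sums truncated at `N`. -/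
noncomputable def pfCoeff (N k : ℕ) : PowerSeries ℝ :=
  (-1) ^ k * ((2 * C ((k + 1 : ℕ) : ℝ) - X) * invSubX ((k + 1 : ℕ) : ℝ)) * harmProd k *
    ratioProd N (k + 1)

/-- `1 / (m (m - X))`. -/
noncomputable def quadInv (m : ℕ) : PowerSeries ℝ := C (m : ℝ)⁻¹ * invSubX (m : ℝ)

theorem quadInv_spec (m : ℕ) :
    (C ((m : ℝ) + 1) * (C ((m : ℝ) + 1) - X)) * quadInv (m + 1) = 1 := by
  have e1 := sub_X_mul_invSubX (a := (m : ℝ) + 1) (by positivity)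
  have e2 : C ((m : ℝ) + 1) * C ((m : ℝ) + 1)⁻¹ = 1 := by
    rw [← map_mul, mul_inv_cancel₀ (by positivity), map_one]
  rw [quadInv]
  push_cast
  linear_combination C ((m : ℝ) + 1) * C ((m : ℝ) + 1)⁻¹ * e1 + e2

/-- With `n = N + 1`, `m = k + 1`, the numerator in `ratioProd_shift` is `(n - m)(n + m - X) = n(n -
X) - m(m - X)`, a difference of reciprocals of `quadInv`. -/
theorem pfCoeff_shift (N k : ℕ) :
    (pfCoeff (N + 1) k - pfCoeff N k) * quadInv (k + 1) =
      pfCoeff (N + 1) k * quadInv (N + 1) := by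
  have h := ratioProd_shift N (k + 1)
  have h1 := quadInv_spec k
  have h2 := quadInv_spec N
  simp only [pfCoeff]
  generalize (-1) ^ k * ((2 * C ((k + 1 : ℕ) : ℝ) - X) * invSubX ((k + 1 : ℕ) : ℝ)) *
    harmProd k = A
  generalize ratioProd N (k + 1) = u at *
  generalize ratioProd (N + 1) (k + 1) = v at *
  generalize quadInv (k + 1) = p at *
  generalize quadInv (N + 1) = q at *
  simp only [map_add, map_sub, map_natCast, Nat.cast_add, Nat.cast_one, map_one] at *
  linear_combination (-A * p * q) * h + (A * v * q) * h1 - (A * v * p - A * u * p) * h2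

theorem pfCoeff_eq_zero {N k : ℕ} (h : N ≤ k) : pfCoeff N k = 0 := by
  have : ratioProd N (k + 1) = 0 :=
    prod_eq_zero (i := N) (mem_range.2 (by omega)) (by simp)
  rw [pfCoeff, this, mul_zero]

theorem sum_pfCoeff (N : ℕ) :
    ∑ k ∈ range (N + 1), pfCoeff (N + 1) k =
      C ((N + 1 : ℕ) : ℝ) * invSubX ((N + 1 : ℕ) : ℝ) := by
  -- After clearing `N + 1 - X` the summands telescope along `D`; `D 0 = N + 1`, and the factor `N +
  -- 1 - k` kills `D (N + 1)`.
  let D : ℕ → PowerSeries ℝ := fun k =>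
    (-1) ^ k * C (((N + 1 : ℕ) : ℝ) - k) * harmProd k * ratioProd (N + 1) k
  have hD : ∀ k, (C ((N + 1 : ℕ) : ℝ) - X) * pfCoeff (N + 1) k = D k - D (k + 1) := by
    intro k
    have h1 : harmProd (k + 1) = harmProd k * (C ((k : ℝ) + 1) * invSubX ((k : ℝ) + 1)) := by
      rw [harmProd, prod_range_succ, ← harmProd]; push_cast; rfl
    have h2 : ratioProd (N + 1) (k + 1) =
        ratioProd (N + 1) k * (C ((N : ℝ) + 1 - k) * invSubX ((N : ℝ) + 1 + 1 + k)) := by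
      rw [ratioProd, prod_range_succ, ← ratioProd]; push_cast; rfl
    have e1 := sub_X_mul_invSubX (a := (k : ℝ) + 1) (by positivity)
    have e2 := sub_X_mul_invSubX (a := (N : ℝ) + 1 + 1 + k) (by positivity)
    simp only [D, pfCoeff, h1, h2, pow_succ]
    simp only [map_add, map_sub, map_natCast, Nat.cast_add, Nat.cast_one, map_one] at *
    linear_combination (-1) ^ k * ((N : PowerSeries ℝ) + 1 - k) * harmProd k *
      ratioProd (N + 1) k * (((N : PowerSeries ℝ) + 1 + 1 + k - X) *
        invSubX ((N : ℝ) + 1 + 1 + k) * e1 + e2)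
  have hsum : (C ((N + 1 : ℕ) : ℝ) - X) * ∑ k ∈ range (N + 1), pfCoeff (N + 1) k =
      C ((N + 1 : ℕ) : ℝ) := by
    rw [mul_sum, sum_congr rfl fun k _ => hD k, sum_range_sub']
    simp [D, harmProd, ratioProd]
  have e := sub_X_mul_invSubX (a := ((N + 1 : ℕ) : ℝ)) (by positivity)
  rw [← hsum]
  linear_combination -(∑ k ∈ range (N + 1), pfCoeff (N + 1) k) * e

/-- The partial fraction expansion of the generating function of the truncated star sums. -/
noncomputable def pfSum (s N : ℕ) : PowerSeries ℝ :=
  ∑ k ∈ range N, pfCoeff N k * quadInv (k + 1) ^ s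

theorem pfSum_succ_succ (s N : ℕ) :
    pfSum (s + 1) (N + 1) = pfSum (s + 1) N + pfSum s (N + 1) * quadInv (N + 1) := by
  -- The added term `k = N` vanishes, so all three sums share one range.
  have h : pfSum (s + 1) N = ∑ k ∈ range (N + 1), pfCoeff N k * quadInv (k + 1) ^ (s + 1) := by
    rw [pfSum, sum_range_succ, pfCoeff_eq_zero le_rfl, zero_mul, add_zero]
  rw [h, pfSum, pfSum, sum_mul, ← sum_add_distrib]
  refine sum_congr rfl fun k _ => ?_
  linear_combination quadInv (k + 1) ^ s * pfCoeff_shift N k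

theorem pfSum_succ (s N : ℕ) :
    pfSum (s + 1) N = ∑ M ∈ range N, pfSum s (M + 1) * quadInv (M + 1) := by
  induction N with
  | zero => simp [pfSum]
  | succ N ih => rw [pfSum_succ_succ, sum_range_succ, ih]

theorem pfSum_zero (N : ℕ) :
    pfSum 0 (N + 1) = C ((N + 1 : ℕ) : ℝ) * invSubX ((N + 1 : ℕ) : ℝ) := by
  simp only [pfSum, pow_zero, mul_one]
  exact sum_pfCoeff N

/-! ### Coefficients of the truncated generating function. -/

theorem coeff_quadInv (m r : ℕ) : coeff r (quadInv m) = ((m : ℝ) ^ (r + 2))⁻¹ := by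
  rw [quadInv, coeff_C_mul, invSubX, coeff_mk, ← inv_pow]
  ring

theorem sum_piAntidiag_snoc {n r : ℕ} (f : (Fin (n + 1) → ℕ) → ℝ) :
    ∑ ρ ∈ piAntidiag (univ : Finset (Fin (n + 1))) r, f ρ =
      ∑ p ∈ antidiagonal r, ∑ ρ ∈ piAntidiag (univ : Finset (Fin n)) p.1,
        f (Fin.snoc (α := fun _ => ℕ) ρ p.2) := by
  rw [Finset.sum_sigma']
  symm
  refine Finset.sum_bij' (fun p _ => Fin.snoc (α := fun _ => ℕ) p.2 p.1.2)
    (fun m _ => ⟨(∑ j, Fin.init m j, m (Fin.last n)), Fin.init m⟩) ?_ ?_ ?_ ?_ ?_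
  · rintro ⟨⟨a, b⟩, ρ⟩ h
    simp only [mem_sigma, HasAntidiagonal.mem_antidiagonal, mem_piAntidiag, mem_univ,
      implies_true, and_true, Fin.sum_univ_castSucc, Fin.snoc_castSucc, Fin.snoc_last] at h ⊢
    rw [h.2, h.1]
  · intro ρ h
    simp only [mem_sigma, HasAntidiagonal.mem_antidiagonal, mem_piAntidiag, mem_univ,
      implies_true, and_true, Fin.sum_univ_castSucc] at h ⊢
    exact h
  · rintro ⟨⟨a, b⟩, ρ⟩ h
    simp at h
    obtain ⟨h, rfl⟩ := h
    simp
  · intro m h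
    simp
  · intro p h
    rfl

theorem coeff_pfSum (s r N : ℕ) :
    coeff r (pfSum (s + 1) N) = ∑ ρ ∈ piAntidiag (univ : Finset (Fin (s + 1))) r,
      ((ρ 0 : ℝ) + 1) * truncStar (s + 1) (fun j => ρ j + 2) N := by
  induction s generalizing r N with
  | zero =>
    have hset : piAntidiag (univ : Finset (Fin 1)) r = {fun _ => r} := by
      ext ρ
      simp only [mem_piAntidiag, mem_singleton, mem_univ, implies_true, and_true,
        Fin.sum_univ_one]
      exact ⟨fun h => funext fun j => by rw [Subsingleton.elim j 0, h], fun h => by rw [h]⟩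
    rw [hset, sum_singleton, pfSum_succ, map_sum]
    simp only [truncStar, mul_sum]
    refine sum_congr rfl fun M _ => ?_
    rw [pfSum_zero, coeff_mul]
    -- All `r + 1` products in the convolution are equal; their number is the weight `r₁ + 1`.
    have : ∀ p ∈ antidiagonal r, coeff p.1 (C ((M + 1 : ℕ) : ℝ) * invSubX ((M + 1 : ℕ) : ℝ)) *
        coeff p.2 (quadInv (M + 1)) = (((M + 1 : ℕ) : ℝ) ^ (r + 2))⁻¹ := by
      rintro ⟨a, b⟩ h
      obtain rfl : a + b = r := HasAntidiagonal.mem_antidiagonal.1 h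
      have hM : ((M + 1 : ℕ) : ℝ) ≠ 0 := by positivity
      rw [coeff_quadInv, coeff_C_mul, invSubX, coeff_mk, pow_succ', mul_inv_cancel_left₀ hM,
        inv_pow, ← mul_inv, ← pow_add, add_assoc]
    rw [sum_congr rfl this]
    simp
  | succ s ih =>
    rw [sum_piAntidiag_snoc, pfSum_succ, map_sum]
    have hinit : ∀ (ρ : Fin (s + 1) → ℕ) (b : ℕ),
        (Fin.init fun j => Fin.snoc (α := fun _ => ℕ) ρ b j + 2) = fun j => ρ j + 2 := by
      intro ρ b
      ext j
      simp [Fin.init]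
    have hzero : ∀ (ρ : Fin (s + 1) → ℕ) (b : ℕ),
        (Fin.snoc (α := fun _ => ℕ) ρ b : Fin (s + 2) → ℕ) 0 = ρ 0 := fun ρ b =>
      Fin.snoc_castSucc (α := fun _ => ℕ) b ρ 0
    have hr : ∀ (ρ : Fin (s + 1) → ℕ) (b : ℕ), truncStar (s + 1 + 1)
        (fun j => Fin.snoc (α := fun _ => ℕ) ρ b j + 2) N = ∑ M ∈ range N,
          (((M + 1 : ℕ) : ℝ) ^ (b + 2))⁻¹ * truncStar (s + 1) (fun j => ρ j + 2) (M + 1) := by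
      intro ρ b
      rw [truncStar, hinit]
      simp
    simp only [hr, hzero, coeff_mul, ih, coeff_quadInv, mul_sum, sum_mul]
    rw [sum_comm]
    refine sum_congr rfl fun p _ => ?_
    rw [sum_comm]
    refine sum_congr rfl fun ρ _ => sum_congr rfl fun M _ => ?_
    ring

/-! ### Coefficient bounds and expansion of the limiting factors. -/

/-- The coefficients of `p` are bounded in absolute value by those of `q`. -/
def CoeffLE (p q : PowerSeries ℝ) : Prop := ∀ i, |coeff i p| ≤ coeff i q

theorem CoeffLE.mul {p q p' q' : PowerSeries ℝ} (h : CoeffLE p q) (h' : CoeffLE p' q') :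
    CoeffLE (p * p') (q * q') := by
  intro i
  rw [coeff_mul, coeff_mul]
  refine (abs_sum_le_sum_abs _ _).trans (sum_le_sum fun x _ => ?_)
  rw [abs_mul]
  exact mul_le_mul (h _) (h' _) (abs_nonneg _) ((abs_nonneg _).trans (h _))

theorem CoeffLE.prod {m : ℕ} {f g : ℕ → PowerSeries ℝ} (h : ∀ j, CoeffLE (f j) (g j)) :
    CoeffLE (∏ j ∈ range m, f j) (∏ j ∈ range m, g j) := by
  induction m with
  | zero =>
    intro i
    simp only [range_zero, prod_empty, coeff_one]
    split_ifs <;> simp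
  | succ m ih =>
    rw [prod_range_succ, prod_range_succ]
    exact ih.mul (h m)

/-- Factor by factor: `|N - j| ≤ N + 1 + j` and `1/(N + 1 + j) ≤ 1/(j + 1)`. The bound is uniform in
`N`, as domination requires. -/
theorem ratioProd_coeffLE (N m : ℕ) : CoeffLE (ratioProd N m) (harmProd m) := by
  refine CoeffLE.prod fun j i => ?_
  rw [coeff_C_mul, coeff_C_mul, invSubX, invSubX, coeff_mk, coeff_mk, abs_mul]
  have hN : (0 : ℝ) ≤ N := Nat.cast_nonneg N
  have hj : (0 : ℝ) ≤ j := Nat.cast_nonneg j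
  have h1 : |(N : ℝ) - j| ≤ ((N + 1 + j : ℕ) : ℝ) := by
    push_cast
    rw [abs_le]
    constructor <;> linarith
  have h2 : ((N + 1 + j : ℕ) : ℝ)⁻¹ ≤ ((j + 1 : ℕ) : ℝ)⁻¹ :=
    inv_anti₀ (by positivity) (by push_cast; linarith)
  rw [abs_of_nonneg (by positivity : (0 : ℝ) ≤ ((N + 1 + j : ℕ) : ℝ)⁻¹ ^ (i + 1)), pow_succ',
    pow_succ', mul_inv_cancel_left₀ (by positivity)]
  calc _ ≤ ((N + 1 + j : ℕ) : ℝ) * (((N + 1 + j : ℕ) : ℝ)⁻¹ * ((N + 1 + j : ℕ) : ℝ)⁻¹ ^ i) := by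
        gcongr
    _ = ((N + 1 + j : ℕ) : ℝ)⁻¹ ^ i := mul_inv_cancel_left₀ (by positivity) _
    _ ≤ _ := by gcongr

theorem coeff_harmProd (a m : ℕ) : coeff a (harmProd m) = truncStar a (fun _ => 1) m := by
  have hrec : ∀ m : ℕ, (C ((m : ℝ) + 1) - X) * harmProd (m + 1) = C ((m : ℝ) + 1) * harmProd m := by
    intro m
    have e := sub_X_mul_invSubX (a := (m : ℝ) + 1) (by positivity)
    rw [harmProd, prod_range_succ, ← harmProd]
    push_cast
    linear_combination C ((m : ℝ) + 1) * harmProd m * e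
  induction a generalizing m with
  | zero =>
    rw [truncStar, harmProd, coeff_zero_eq_constantCoeff, map_prod]
    refine prod_eq_one fun j _ => ?_
    rw [← coeff_zero_eq_constantCoeff_apply, coeff_C_mul, invSubX, coeff_mk, zero_add, pow_one,
      mul_inv_cancel₀ (by positivity)]
  | succ a ih =>
    induction m with
    | zero => simp [harmProd, truncStar, coeff_one]
    | succ m ihm =>
      have h := congrArg (coeff (a + 1)) (hrec m)
      rw [sub_mul, map_sub, coeff_C_mul, coeff_C_mul, coeff_succ_X_mul, ihm, ih] at h
      have h2 : truncStar (a + 1) (fun _ => 1) (m + 1) = truncStar (a + 1) (fun _ => 1) m +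
          ((m : ℝ) + 1)⁻¹ * truncStar a (fun _ => 1) (m + 1) := by
        simp only [truncStar, sum_range_succ, pow_one]
        push_cast
        rfl
      have : ((m : ℝ) + 1) ≠ 0 := by positivity
      rw [h2]
      field_simp
      linarith

theorem harmProd_coeffLE (m : ℕ) :
    CoeffLE (harmProd (m + 1)) (C (natRoot (m + 1)) * PowerSeries.mk fun i => (4 : ℝ) ^ i) := by
  intro i
  rw [coeff_harmProd, abs_of_nonneg (truncStar_nonneg _ _ _), coeff_C_mul, coeff_mk, mul_comm]
  exact truncStar_le i _ (fun _ => le_rfl) m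

/-- Multiplying by `m(m - X)`, with `m` here the shifted index, lowers `d` by one; on coefficients
this is the Pascal rule for `multichoose`. -/
theorem coeff_quadInv_pow (m d i : ℕ) :
    coeff i (quadInv (m + 1) ^ d) =
      (d.multichoose i : ℝ) * (((m + 1 : ℕ) : ℝ) ^ (2 * d + i))⁻¹ := by
  have hm : ((m : ℝ) + 1) * ((m : ℝ) + 1)⁻¹ = 1 := mul_inv_cancel₀ (by positivity)
  rw [← inv_pow]
  push_cast
  generalize ((m : ℝ) + 1)⁻¹ = t at hm ⊢
  induction d generalizing i with
  | zero => cases i <;> simp [coeff_one]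
  | succ d ih =>
    have hrec : C ((m : ℝ) + 1) * ((C ((m : ℝ) + 1) - X) * quadInv (m + 1) ^ (d + 1)) =
        quadInv (m + 1) ^ d := by
      linear_combination quadInv (m + 1) ^ d * quadInv_spec m
    have h := congrArg (coeff i) hrec
    rw [coeff_C_mul, sub_mul, map_sub, coeff_C_mul, ih] at h
    induction i with
    | zero =>
      rw [coeff_zero_X_mul] at h
      simp only [Nat.multichoose_zero_right, Nat.cast_one] at h ⊢
      generalize coeff 0 (quadInv (m + 1) ^ (d + 1)) = c at h ⊢
      linear_combination t ^ 2 * h - c * (((m : ℝ) + 1) * t + 1) * hm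
    | succ i ihi =>
      have h' := congrArg (coeff i) hrec
      rw [coeff_C_mul, sub_mul, map_sub, coeff_C_mul, ih] at h'
      rw [coeff_succ_X_mul, ihi h'] at h
      rw [Nat.multichoose_succ_succ]
      push_cast
      generalize coeff (i + 1) (quadInv (m + 1) ^ (d + 1)) = c at h ⊢
      linear_combination t ^ 2 * h - c * (((m : ℝ) + 1) * t + 1) * hm +
        ((d + 1).multichoose i : ℝ) * t ^ (2 * (d + 1) + (i + 1)) * hm

theorem ringChoose_eq_multichoose (d i : ℕ) :
    Ring.choose ((d : ℤ) - 1 + i) i = (d.multichoose i : ℤ) := by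
  have e : (d : ℤ) - 1 + i - i + 1 = d := by ring
  rw [Ring.choose, e, Nat.multichoose_eq]
  rfl

/-- The sum of two consecutive multichoose numbers, for `s + 1`. -/
def weight (s i : ℕ) : ℕ := s.multichoose i + (s + 1).multichoose i

/-- `(2 - X / m) / (m (m - X)) ^ (s + 1)` for `m = k + 1`. -/
noncomputable def weightSeries (s k : ℕ) : PowerSeries ℝ :=
  C (((k + 1 : ℕ) : ℝ) ^ 2)⁻¹ * quadInv (k + 1) ^ s + quadInv (k + 1) ^ (s + 1)

theorem coeff_weightSeries (s k i : ℕ) : coeff i (weightSeries s k) =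
    (weight s i : ℝ) * (((k + 1 : ℕ) : ℝ) ^ (2 * (s + 1) + i))⁻¹ := by
  rw [weightSeries, map_add, coeff_C_mul, coeff_quadInv_pow, coeff_quadInv_pow, weight]
  push_cast
  have hm : ((k : ℝ) + 1) ≠ 0 := by positivity
  field_simp
  ring

/-- Moving `m/(m - X)` into `harmProd` leaves `2 - X/m = 1 + (m - X)/m`; the second summand cancels
one `quadInv` down to `1/m²`, whence the two binomials. -/
theorem pfCoeff_mul_quadInv_pow (s N k : ℕ) :
    pfCoeff N k * quadInv (k + 1) ^ (s + 1) =
      C ((-1) ^ k) * (weightSeries s k * harmProd (k + 1)) * ratioProd N (k + 1) := by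
  have e1 := sub_X_mul_invSubX (a := (k : ℝ) + 1) (by positivity)
  have e2 : C ((k : ℝ) + 1) * C ((k : ℝ) + 1)⁻¹ = 1 := by
    rw [← map_mul, mul_inv_cancel₀ (by positivity), map_one]
  have e3 : quadInv (k + 1) = C ((k : ℝ) + 1)⁻¹ * invSubX ((k : ℝ) + 1) := by
    rw [quadInv]; push_cast; rfl
  have e4 : harmProd (k + 1) = harmProd k * (C ((k : ℝ) + 1) * invSubX ((k : ℝ) + 1)) := by
    rw [harmProd, prod_range_succ, ← harmProd]; push_cast; rfl
  rw [pfCoeff, weightSeries, e4, pow_succ (quadInv (k + 1)), ← inv_pow]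
  push_cast
  simp only [map_pow, map_neg, map_one]
  generalize quadInv (k + 1) ^ s = q
  rw [e3]
  linear_combination (-1) ^ k * invSubX ((k : ℝ) + 1) * harmProd k * ratioProd N (k + 1) * q *
    C ((k : ℝ) + 1)⁻¹ * (e1 - e2)

theorem weightSeries_coeffLE (s k : ℕ) : CoeffLE (weightSeries s k)
    (C (((k + 1 : ℕ) : ℝ) ^ 2)⁻¹ * PowerSeries.mk fun i => (weight s i : ℝ)) := by
  intro i
  rw [coeff_weightSeries, abs_of_nonneg (by positivity), coeff_C_mul, coeff_mk, mul_comm]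
  have : (((k + 1 : ℕ) : ℝ) ^ (2 * (s + 1) + i))⁻¹ ≤ (((k + 1 : ℕ) : ℝ) ^ 2)⁻¹ :=
    inv_anti₀ (by positivity)
      (pow_le_pow_right₀ (by exact_mod_cast Nat.le_add_left 1 k) (by omega))
  gcongr

/-! ### Passage to the limit and comparison of coefficients. -/

theorem tendsto_coeff_mul {f g : ℕ → PowerSeries ℝ} {p q : PowerSeries ℝ}
    (hf : ∀ i, Tendsto (fun N => coeff i (f N)) atTop (𝓝 (coeff i p)))
    (hg : ∀ i, Tendsto (fun N => coeff i (g N)) atTop (𝓝 (coeff i q))) (i : ℕ) :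
    Tendsto (fun N => coeff i (f N * g N)) atTop (𝓝 (coeff i (p * q))) := by
  simp only [coeff_mul]
  exact tendsto_finsetSum _ fun x _ => (hf _).mul (hg _)

theorem tendsto_coeff_ratioProd (m i : ℕ) :
    Tendsto (fun N => coeff i (ratioProd N m)) atTop (𝓝 (coeff i 1)) := by
  induction m generalizing i with
  | zero => simp [ratioProd]
  | succ m ih =>
    simp only [ratioProd, prod_range_succ]
    rw [← mul_one (1 : PowerSeries ℝ)]
    refine tendsto_coeff_mul ih (fun i => ?_) i
    simp only [coeff_C_mul, invSubX, coeff_mk]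
    have hinv : Tendsto (fun N : ℕ => ((N + 1 + m : ℕ) : ℝ)⁻¹) atTop (𝓝 0) := by
      have := tendsto_inv_atTop_nhds_zero_nat (𝕜 := ℝ)
      exact (this.comp (tendsto_add_atTop_nat (1 + m))).congr fun N => by
        simp [add_assoc]
    have hratio : Tendsto (fun N : ℕ => ((N : ℝ) - m) * ((N + 1 + m : ℕ) : ℝ)⁻¹) atTop
        (𝓝 1) := by
      have h : Tendsto (fun N : ℕ => 1 - (2 * m + 1 : ℝ) * ((N + 1 + m : ℕ) : ℝ)⁻¹) atTop
          (𝓝 (1 - (2 * m + 1 : ℝ) * 0)) := tendsto_const_nhds.sub (hinv.const_mul _)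
      rw [mul_zero, sub_zero] at h
      refine h.congr fun N => ?_
      have : (N : ℝ) + 1 + m ≠ 0 := by positivity
      push_cast
      field_simp
      ring
    have hfin := hratio.mul (hinv.pow i)
    have hc : (1 : ℝ) * 0 ^ i = coeff i (1 : PowerSeries ℝ) := by
      cases i <;> simp [coeff_one]
    rw [hc] at hfin
    exact hfin.congr fun N => by ring

theorem tendsto_coeff_pfSum (s r : ℕ) :
    Tendsto (fun N => coeff r (pfSum (s + 1) N)) atTop
      (𝓝 (∑' k, (-1 : ℝ) ^ k * coeff r (weightSeries s k * harmProd (k + 1)))) := by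
  -- The three series majorize `weightSeries`, `harmProd` and `ratioProd`, up to powers of `k + 1`
  -- that make up the summable factor.
  let K : ℝ := coeff r ((PowerSeries.mk fun i => (weight s i : ℝ)) *
    (PowerSeries.mk fun i => (4 : ℝ) ^ i) * PowerSeries.mk fun i => (4 : ℝ) ^ i)
  have hsum : ∀ N, coeff r (pfSum (s + 1) N) =
      ∑' k, coeff r (pfCoeff N k * quadInv (k + 1) ^ (s + 1)) := by
    intro N
    rw [tsum_eq_sum (s := range N), pfSum, map_sum]
    intro k hk
    rw [pfCoeff_eq_zero (by simpa using hk), zero_mul, map_zero]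
  simp only [hsum]
  refine tendsto_tsum_of_dominated_convergence (summable_natRoot_sq_div.mul_left K)
    (fun k => ?_) (Eventually.of_forall fun N k => ?_)
  · simp only [pfCoeff_mul_quadInv_pow]
    rw [← coeff_C_mul]
    have := tendsto_coeff_mul (f := fun _ => C ((-1 : ℝ) ^ k) *
      (weightSeries s k * harmProd (k + 1))) (fun _ => tendsto_const_nhds)
      (tendsto_coeff_ratioProd (k + 1)) r
    rwa [mul_one] at this
  · rw [pfCoeff_mul_quadInv_pow, mul_assoc, coeff_C_mul, Real.norm_eq_abs, abs_mul, abs_pow,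
      abs_neg, abs_one, one_pow, one_mul]
    have h := ((weightSeries_coeffLE s k).mul (harmProd_coeffLE k)).mul
      (fun i => (ratioProd_coeffLE N (k + 1) i).trans
        ((le_abs_self _).trans (harmProd_coeffLE k i))) r
    refine h.trans (le_of_eq ?_)
    rw [← mul_comm (natRoot (k + 1) ^ 2 / _) K, ← coeff_C_mul]
    congr 1
    rw [div_eq_mul_inv, map_mul, map_pow]
    ring

theorem one_le_onesThen (a : ℕ) {b : ℕ} (hb : 1 ≤ b) (j : Fin (a + 1)) :
    1 ≤ onesThen a b j := by
  refine Fin.lastCases ?_ (fun j => ?_) j <;> simp [onesThen, hb]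

theorem hasSum_weight_zetaStarMinus (s r : ℕ) :
    HasSum (fun k => (-1 : ℝ) ^ k * coeff r (weightSeries s k * harmProd (k + 1)))
      (∑ i ∈ range (r + 1), (weight s i : ℝ) *
        zetaStarMinus (Nat.le_add_left 1 (r - i)) (onesThen (r - i) (2 * (s + 1) + i))) := by
  have h := hasSum_sum (s := range (r + 1)) fun i _ =>
    (hasSum_outerTerm (z := -1) (by simp) (Nat.le_add_left 1 (r - i))
      (k := onesThen (r - i) (2 * (s + 1) + i)) (one_le_onesThen _ (by omega))
      (by simp [onesThen]; omega)).mul_left (weight s i : ℝ)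
  refine Eq.mp (congrArg (fun f => HasSum f _) (funext fun k => Eq.symm ?_)) h
  rw [coeff_mul, Finset.Nat.sum_antidiagonal_eq_sum_range_succ
    (fun i j => coeff i (weightSeries s k) * coeff j (harmProd (k + 1))), mul_sum]
  refine sum_congr rfl fun i _ => ?_
  have hinit : Fin.init (onesThen (r - i) (2 * (s + 1) + i)) = fun _ => 1 :=
    Fin.init_snoc (α := fun _ => ℕ) _ _
  have hlast : onesThen (r - i) (2 * (s + 1) + i) (Fin.last _) = 2 * (s + 1) + i :=
    Fin.snoc_last (α := fun _ => ℕ) _ _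
  rw [coeff_weightSeries, coeff_harmProd, outerTerm, hinit, hlast]
  ring

theorem theorem2 (r s : ℕ) (hs : 1 ≤ s) :
    (∀ i ∈ Finset.range (r + 1),
      Summable (mplStarTerm (-1) (Nat.le_add_left 1 (r - i)) (onesThen (r - i) (2 * s + i)))) ∧
    (∀ ρ ∈ Finset.piAntidiag (Finset.univ : Finset (Fin s)) r,
      Summable (mplStarTerm 1 hs (fun j => ρ j + 2))) ∧
    ∑ i ∈ Finset.range (r + 1),
        ((Ring.choose ((s : ℤ) - 2 + i) i + Ring.choose ((s : ℤ) - 1 + i) i : ℤ) : ℝ) *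
          zetaStarMinus (Nat.le_add_left 1 (r - i)) (onesThen (r - i) (2 * s + i)) =
      ∑ ρ ∈ Finset.piAntidiag (Finset.univ : Finset (Fin s)) r,
        ((ρ ⟨0, hs⟩ : ℝ) + 1) * zetaStar hs (fun j => ρ j + 2) := by
  obtain ⟨s, rfl⟩ : ∃ t, s = t + 1 := ⟨s - 1, by omega⟩
  refine ⟨fun i _ => ?_, fun ρ _ => ?_, ?_⟩
  · exact summable_mplStarTerm (by simp) _ (one_le_onesThen _ (by omega))
      (by simp [onesThen]; omega)
  · exact summable_mplStarTerm (by simp) _ (fun j => by omega) (by omega)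
  · have hw : ∀ i : ℕ, ((Ring.choose (((s + 1 : ℕ) : ℤ) - 2 + i) i +
        Ring.choose (((s + 1 : ℕ) : ℤ) - 1 + i) i : ℤ) : ℝ) = weight s i := by
      intro i
      -- For `s = 0` the upper entry is `i - 1`, and `multichoose 0 i` gives the required `1` at `i
      -- = 0` and `0` otherwise.
      have e : ((s + 1 : ℕ) : ℤ) - 2 + i = (s : ℤ) - 1 + i := by push_cast; ring
      rw [e, ringChoose_eq_multichoose, ringChoose_eq_multichoose, weight]
      push_cast
      ring
    simp only [hw]
    rw [← (hasSum_weight_zetaStarMinus s r).tsum_eq]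
    refine tendsto_nhds_unique (tendsto_coeff_pfSum s r) ?_
    simp only [coeff_pfSum]
    refine tendsto_finsetSum _ fun ρ _ => Tendsto.const_mul _ ?_
    have h := tendsto_sum_outerTerm (z := 1) (by simp) hs (k := fun j => ρ j + 2)
      (fun j => by omega) (by omega)
    refine h.congr fun N => ?_
    simp [outerTerm, truncStar]
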